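/- Let $E$ be a (real) Banach lattice. A net $(x_\alpha)$ in $E$ is uaw-convergent to $x \in E$ if $|x_\alpha - x| \wedge u \to 0$ weakly for every $u \in E^+$. A subset $A$ of $E$ is relatively uaw-compact if it is norm bounded and every net in $A$ has a subnet that is uaw-convergent to some point of $E$. Then the following statements are equivalent: 1. The lattice operations of $E$ are weakly sequentially continuous, that is, whenever $x_n \to x$ and $y_n \to y$ weakly in $E$, also $x_n \vee y_n \to x \vee y$ and $x_n \wedge y_n \to x \wedge y$ weakly. 2. Every relatively weakly compact subset of $E$ is relatively uaw-compact. -/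

import Mathlib

universe u

open Filter Topology

/-- Weak convergence (for the topology `σ(E, E')`) of a family `x` along a filter `l` to `a`. -/
def WeakTendsto {E : Type*} [NormedAddCommGroup E] [NormedSpace ℝ E] {ι : Type*}
    (x : ι → E) (l : Filter ι) (a : E) : Prop :=
  Tendsto (fun i => toWeakSpace ℝ E (x i)) l (𝓝 (toWeakSpace ℝ E a))

/-- The lattice operations `(x, y) ↦ x ⊔ y` and `(x, y) ↦ x ⊓ y` are weakly sequentially
continuous. -/
def WeaklySeqContinuousLatticeOps (E : Type*) [NormedAddCommGroup E] [NormedSpace ℝ E]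
    [Lattice E] : Prop :=
  ∀ (x y : ℕ → E) (a b : E), WeakTendsto x atTop a → WeakTendsto y atTop b →
    WeakTendsto (fun n => x n ⊔ y n) atTop (a ⊔ b) ∧
    WeakTendsto (fun n => x n ⊓ y n) atTop (a ⊓ b)

/-- Unbounded absolute weak convergence: `|x i - a| ⊓ u → 0` weakly for every `u ≥ 0`. -/
def UawTendsto {E : Type*} [NormedAddCommGroup E] [NormedSpace ℝ E] [Lattice E] {ι : Type*}
    (x : ι → E) (l : Filter ι) (a : E) : Prop :=
  ∀ u : E, 0 ≤ u → WeakTendsto (fun i => |x i - a| ⊓ u) l 0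

/-- The weak closure of `A` is weakly compact. -/
def RelativelyWeaklyCompact {E : Type*} [NormedAddCommGroup E] [NormedSpace ℝ E]
    (A : Set E) : Prop :=
  IsCompact (closure (toWeakSpace ℝ E '' A))

/-- `A` is norm bounded and every net in `A` has a subnet that is uaw-convergent to some point
of `E`. A net is a family indexed by a nonempty directed preordered set; a subnet of `x` is
`x ∘ φ` for a map `φ` from another such set that is eventually above every index. It is enough
to use index sets in the universe of `E`, since every proper filter on `E` is the image filter of a net
with such an index set. -/
def RelativelyUawCompact {E : Type u} [NormedAddCommGroup E] [NormedSpace ℝ E] [Lattice E]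
    (A : Set E) : Prop :=
  Bornology.IsBounded A ∧
  ∀ (ι : Type u) [Preorder ι] [IsDirectedOrder ι] [Nonempty ι] (x : ι → E), (∀ i, x i ∈ A) →
    ∃ (κ : Type u) (_ : Preorder κ) (_ : IsDirectedOrder κ) (_ : Nonempty κ) (φ : κ → ι),
      Tendsto φ atTop atTop ∧ ∃ a : E, UawTendsto (x ∘ φ) atTop a

/-! Weak limits along an arbitrary filter on a relatively weakly compact set are governed by weakly
convergent sequences: an element of the weak closure is already in the weak closure of a countable
subset, and on a separable subspace countably many functionals decide convergence. So if the
lattice operations are weakly sequentially continuous, then `z → a` weakly along a filter on such a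
set forces `|z - a| → 0` weakly, which is more than uaw-convergence.

Conversely, let `x n → 0` weakly and let `f` be a positive functional. If `v k ≤ |x (m k)|` are
disjoint, the components of `f` carried by the `v k` yield an operator into `ℓ¹`, where weakly
convergent sequences converge in norm (Schur's theorem, here via Baire category on the compact space
of signs), and hence `f (v k) → 0`. Cutting disjoint sequences out of arbitrary ones then shows that
for every `ε > 0` there is `u ≥ 0` with `f (|x n| - u)⁺ ≤ ε` for all `n`. Since
`|y| = |y| ⊓ u + (|y| - u)⁺`, a uaw-limit point of the sequence is an absolute weak limit point, so
it is `0`, and every subsequence has a further subsequence along which `f |x n| → 0`.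
-/

section WeakTopology

variable {E F : Type*} [NormedAddCommGroup E] [NormedSpace ℝ E]
  [NormedAddCommGroup F] [NormedSpace ℝ F] {ι κ : Type*} {l : Filter ι} {a b : E}

theorem weakTendsto_iff {x : ι → E} :
    WeakTendsto x l a ↔ ∀ φ : StrongDual ℝ E, Tendsto (fun i => φ (x i)) l (𝓝 (φ a)) := by
  refine WeakBilin.tendsto_iff_forall_eval_tendsto _ fun u v h => ?_
  refine sub_eq_zero.1 (SeparatingDual.eq_zero_of_forall_dual_eq_zero (R := ℝ) fun φ => ?_)
  rw [map_sub, sub_eq_zero]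
  exact LinearMap.congr_fun h φ

theorem continuous_apply_toWeakSpace_symm (φ : StrongDual ℝ E) :
    Continuous fun x : WeakSpace ℝ E => φ ((toWeakSpace ℝ E).symm x) :=
  WeakBilin.eval_continuous _ φ

theorem WeakTendsto.unique [l.NeBot] {x : ι → E} (ha : WeakTendsto x l a)
    (hb : WeakTendsto x l b) : a = b :=
  (toWeakSpace ℝ E).injective (tendsto_nhds_unique ha hb)

theorem WeakTendsto.comp {x : ι → E} {k : Filter κ} {θ : κ → ι} (hx : WeakTendsto x l a)
    (hθ : Tendsto θ k l) : WeakTendsto (x ∘ θ) k a :=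
  Tendsto.comp (g := fun i => toWeakSpace ℝ E (x i)) hx hθ

theorem WeakTendsto.add {x y : ι → E} (hx : WeakTendsto x l a) (hy : WeakTendsto y l b) :
    WeakTendsto (fun i => x i + y i) l (a + b) :=
  weakTendsto_iff.2 fun φ => by
    simpa using (weakTendsto_iff.1 hx φ).add (weakTendsto_iff.1 hy φ)

theorem WeakTendsto.neg {x : ι → E} (hx : WeakTendsto x l a) :
    WeakTendsto (fun i => -x i) l (-a) :=
  weakTendsto_iff.2 fun φ => by simpa using (weakTendsto_iff.1 hx φ).neg

theorem WeakTendsto.sub_const {x : ι → E} (hx : WeakTendsto x l a) (b : E) :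
    WeakTendsto (fun i => x i - b) l (a - b) :=
  weakTendsto_iff.2 fun φ => by simpa using (weakTendsto_iff.1 hx φ).sub_const (φ b)

theorem WeakTendsto.map_clm {x : ι → E} (T : E →L[ℝ] F) (hx : WeakTendsto x l a) :
    WeakTendsto (fun i => T (x i)) l (T a) :=
  weakTendsto_iff.2 fun φ => weakTendsto_iff.1 hx (φ.comp T)

theorem isBounded_of_forall_dual_isBounded {A : Set E}
    (h : ∀ φ : StrongDual ℝ E, Bornology.IsBounded (φ '' A)) : Bornology.IsBounded A := by
  obtain ⟨C, hC⟩ := banach_steinhaus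
    (g := fun a : A => NormedSpace.inclusionInDoubleDualLi ℝ (a : E)) fun φ => by
      obtain ⟨C, hC⟩ := (h φ).exists_norm_le
      exact ⟨C, fun a => hC _ ⟨a, a.2, rfl⟩⟩
  refine isBounded_iff_forall_norm_le.2 ⟨C, fun a ha => ?_⟩
  simpa only [LinearIsometry.norm_map] using hC ⟨a, ha⟩

namespace RelativelyWeaklyCompact

variable {A B : Set E}

theorem mono (hA : RelativelyWeaklyCompact A) (h : B ⊆ A) : RelativelyWeaklyCompact B :=
  hA.of_isClosed_subset isClosed_closure (closure_mono (Set.image_mono h))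

theorem isBounded (hA : RelativelyWeaklyCompact A) : Bornology.IsBounded A := by
  refine isBounded_of_forall_dual_isBounded fun φ => ?_
  refine (hA.image (continuous_apply_toWeakSpace_symm φ)).isBounded.subset ?_
  rintro _ ⟨x, hx, rfl⟩
  exact ⟨_, subset_closure ⟨x, hx, rfl⟩, rfl⟩

theorem exists_le_weakTendsto (hA : RelativelyWeaklyCompact A) (G : Filter E) [G.NeBot]
    (hG : G ≤ 𝓟 A) : ∃ H ≤ G, H.NeBot ∧ ∃ a, WeakTendsto id H a := by
  have hU : ↑((Ultrafilter.of G).map (toWeakSpace ℝ E)) ≤ 𝓟 (closure (toWeakSpace ℝ E '' A)) := by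
    refine le_principal_iff.2 (mem_of_superset (Ultrafilter.of_le G (le_principal_iff.1 hG)) ?_)
    exact fun x hx => subset_closure ⟨x, hx, rfl⟩
  obtain ⟨w, -, hw⟩ := hA.ultrafilter_le_nhds _ hU
  obtain ⟨a, rfl⟩ := (toWeakSpace ℝ E).surjective w
  exact ⟨Ultrafilter.of G, Ultrafilter.of_le G, inferInstance, a, hw⟩

end RelativelyWeaklyCompact

theorem WeakTendsto.relativelyWeaklyCompact_range {x : ℕ → E} (hx : WeakTendsto x atTop a) :
    RelativelyWeaklyCompact (Set.range x) := by
  have hK := Tendsto.isCompact_insert_range hx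
  refine hK.of_isClosed_subset isClosed_closure (closure_minimal ?_ hK.isClosed)
  rintro _ ⟨_, ⟨n, rfl⟩, rfl⟩
  exact Or.inr ⟨n, rfl⟩

theorem exists_forall_abs_apply_sub_lt_of_mem_closure {B : Set E}
    (ha : toWeakSpace ℝ E a ∈ closure (toWeakSpace ℝ E '' B)) [Finite ι]
    (φ : ι → StrongDual ℝ E) {ε : ℝ} (hε : 0 < ε) : ∃ b ∈ B, ∀ i, |φ i (b - a)| < ε := by
  have hU : {x : WeakSpace ℝ E | ∀ i, |φ i ((toWeakSpace ℝ E).symm x) - φ i a| < ε} ∈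
      𝓝 (toWeakSpace ℝ E a) := by
    refine eventually_all.2 fun i => ?_
    have h := ((continuous_apply_toWeakSpace_symm (φ i)).sub (continuous_const (y := φ i a))).abs
    exact (h.tendsto (toWeakSpace ℝ E a)).eventually (gt_mem_nhds (by simpa using hε))
  obtain ⟨_, hx, b, hb, rfl⟩ := mem_closure_iff_nhds.1 ha _ hU
  exact ⟨b, hb, fun i => by simpa using hx i⟩

theorem exists_finset_forall_dual_abs_apply_sub_lt {B : Set E} [Finite ι]
    (ha : toWeakSpace ℝ E a ∈ closure (toWeakSpace ℝ E '' B)) {ε : ℝ} (hε : 0 < ε) :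
    ∃ t : Finset E, ↑t ⊆ B ∧ ∀ φ : ι → StrongDual ℝ E, (∀ i, ‖φ i‖ ≤ 1) →
      ∃ b ∈ t, ∀ i, |φ i (b - a)| < ε := by
  have hK := isCompact_univ_pi fun _ : ι => WeakDual.isCompact_closedBall (𝕜 := ℝ) (E := E) 0 1
  obtain ⟨t, htB, htfin, ht⟩ := hK.elim_finite_subcover_image (b := B)
    (c := fun b => {φ | ∀ i, |φ i (b - a)| < ε})
    (fun b _ => by
      simp only [Set.ofPred_forall]
      refine isOpen_iInter_of_finite fun i => isOpen_lt ?_ continuous_const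
      exact ((WeakDual.eval_continuous _).comp (continuous_apply i)).abs)
    (fun φ _ => by
      simpa using exists_forall_abs_apply_sub_lt_of_mem_closure ha
        (fun i => WeakDual.toStrongDual (φ i)) hε)
  refine ⟨htfin.toFinset, by simpa using htB, fun φ hφ => ?_⟩
  simpa using ht (show (fun i => StrongDual.toWeakDual (φ i)) ∈ _ from fun i _ => by
    simpa using hφ i)

theorem exists_countable_forall_dual_abs_apply_sub_lt {B : Set E}
    (ha : toWeakSpace ℝ E a ∈ closure (toWeakSpace ℝ E '' B)) :
    ∃ C ⊆ B, C.Countable ∧ ∀ (n : ℕ) (φ : Fin n → StrongDual ℝ E), (∀ i, ‖φ i‖ ≤ 1) →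
      ∃ b ∈ C, ∀ i, |φ i (b - a)| < 1 / (n + 1) := by
  choose t htB ht using fun n : ℕ =>
    exists_finset_forall_dual_abs_apply_sub_lt (ι := Fin n) ha (Nat.one_div_pos_of_nat (n := n))
  refine ⟨⋃ n, t n, Set.iUnion_subset htB,
    Set.countable_iUnion fun n => (t n).countable_toSet, fun n φ hφ => ?_⟩
  obtain ⟨b, hb, h⟩ := ht n φ hφ
  exact ⟨b, Set.mem_iUnion_of_mem n hb, h⟩

theorem exists_seq_dual_separating {S : Set E} (hS : TopologicalSpace.IsSeparable S) :
    ∃ d : ℕ → StrongDual ℝ E, (∀ n, ‖d n‖ ≤ 1) ∧ ∀ z ∈ closure S, (∀ n, d n z = 0) → z = 0 := by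
  obtain ⟨c, hc, hSc⟩ := hS
  obtain ⟨e, he⟩ := (hc.insert (0 : E)).exists_eq_range (Set.insert_nonempty _ _)
  choose d hd hde using fun n => exists_dual_vector'' ℝ (e n)
  refine ⟨d, hd, fun z hz h => ?_⟩
  have hz' : z ∈ closure (Set.range e) :=
    closure_minimal (hSc.trans (closure_mono (he ▸ Set.subset_insert _ _))) isClosed_closure hz
  have hle (n : ℕ) : ‖z‖ ≤ 2 * ‖z - e n‖ := by
    have hn : ‖e n‖ ≤ ‖z - e n‖ := by
      simpa [h n, hde n] using (d n).le_of_opNorm_le (hd n) (z - e n)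
    linarith [norm_le_norm_sub_add z (e n)]
  refine norm_le_zero_iff.1 (le_of_forall_pos_lt_add fun ε hε => ?_)
  obtain ⟨_, ⟨n, rfl⟩, hn⟩ := Metric.mem_closure_iff.1 hz' (ε / 2) (half_pos hε)
  rw [dist_eq_norm] at hn
  linarith [hle n]

theorem mem_closure_of_toWeakSpace_mem_closure {M : Set E} (hM : Convex ℝ M)
    (ha : toWeakSpace ℝ E a ∈ closure (toWeakSpace ℝ E '' M)) : a ∈ closure M := by
  rw [← hM.toWeakSpace_closure ℝ] at ha
  obtain ⟨w, hw, h⟩ := ha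
  rwa [← (toWeakSpace ℝ E).injective h]

namespace RelativelyWeaklyCompact

variable {A : Set E}

theorem weakTendsto_of_dual_separating (hA : RelativelyWeaklyCompact A) {x : ι → E}
    (hxA : ∀ i, x i ∈ A) {M : Submodule ℝ E} (hxM : ∀ i, x i - a ∈ M) {d : κ → StrongDual ℝ E}
    (hd : ∀ z ∈ closure (M : Set E), (∀ k, d k z = 0) → z = 0)
    (hx : ∀ k, Tendsto (fun i => d k (x i - a)) l (𝓝 0)) : WeakTendsto x l a := by
  refine hA.tendsto_nhds_of_unique_mapClusterPt
    (Eventually.of_forall fun i => subset_closure ⟨x i, hxA i, rfl⟩) fun w _ hw => ?_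
  obtain ⟨z, rfl⟩ := (toWeakSpace ℝ E).surjective w
  obtain ⟨U, hU, hUz⟩ := mapClusterPt_iff_ultrafilter.1 hw
  have hza : WeakTendsto (fun i => x i - a) U (z - a) := WeakTendsto.sub_const hUz a
  refine congrArg _ (sub_eq_zero.1 (hd _ ?_ fun k => ?_))
  · refine mem_closure_of_toWeakSpace_mem_closure M.convex (mem_closure_of_tendsto hza ?_)
    exact Eventually.of_forall fun i => ⟨_, hxM i, rfl⟩
  · exact tendsto_nhds_unique (weakTendsto_iff.1 hza (d k)) ((hx k).mono_left hU)

theorem exists_seq_weakTendsto (hA : RelativelyWeaklyCompact A)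
    (ha : toWeakSpace ℝ E a ∈ closure (toWeakSpace ℝ E '' A)) :
    ∃ b : ℕ → E, (∀ n, b n ∈ A) ∧ WeakTendsto b atTop a := by
  obtain ⟨C, hCA, hC, h⟩ := exists_countable_forall_dual_abs_apply_sub_lt ha
  obtain ⟨d, hd, hsep⟩ := exists_seq_dual_separating
    (TopologicalSpace.IsSeparable.span (R := ℝ) (hC.image fun c => c - a).isSeparable)
  choose b hbC hb using fun n : ℕ => h n (fun i => d i) fun i => hd i
  refine ⟨b, fun n => hCA (hbC n), hA.weakTendsto_of_dual_separating (fun n => hCA (hbC n))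
    (fun n => Submodule.subset_span (Set.mem_image_of_mem _ (hbC n))) hsep fun k => ?_⟩
  refine squeeze_zero_norm' ?_ tendsto_one_div_add_atTop_nhds_zero_nat
  filter_upwards [eventually_gt_atTop k] with n hn
  exact (hb n ⟨k, hn⟩).le

theorem tendsto_of_seq_tendsto {X : Type*} [TopologicalSpace X] {c : X}
    (hA : RelativelyWeaklyCompact A) {g : E → X}
    (hg : ∀ x : ℕ → E, WeakTendsto x atTop a → Tendsto (g ∘ x) atTop (𝓝 c))
    {x : ι → E} (hxA : ∀ᶠ i in l, x i ∈ A) (hx : WeakTendsto x l a) :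
    Tendsto (g ∘ x) l (𝓝 c) := by
  by_contra hgx
  obtain ⟨U, hU, hfreq⟩ := not_tendsto_iff_exists_frequently_notMem.1 hgx
  have ha : toWeakSpace ℝ E a ∈ closure (toWeakSpace ℝ E '' {z ∈ A | g z ∉ U}) := by
    refine mem_closure_iff_nhds.2 fun V hV => ?_
    obtain ⟨i, ⟨hiU, hiA⟩, hiV⟩ := ((hfreq.and_eventually hxA).and_eventually (hx hV)).exists
    exact ⟨toWeakSpace ℝ E (x i), hiV, x i, ⟨hiA, hiU⟩, rfl⟩
  obtain ⟨b, hb, hba⟩ := (hA.mono (Set.sep_subset _ _)).exists_seq_weakTendsto ha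
  obtain ⟨n, hn⟩ := ((hg b hba).eventually hU).exists
  exact (hb n).2 hn

end RelativelyWeaklyCompact

end WeakTopology

section Schur

variable {ι : Type*}

theorem summable_abs_apply (x : lp (fun _ : ι => ℝ) 1) : Summable fun i => |x i| := by
  simpa using (lp.memℓp x).summable (by simp)

theorem lp_one_norm_eq_tsum_abs (x : lp (fun _ : ι => ℝ) 1) : ‖x‖ = ∑' i, |x i| := by
  simp [lp.norm_eq_tsum_rpow (by simp : 0 < (1 : ENNReal).toReal)]

theorem norm_sign_mul_le_abs (s : SignType) (r : ℝ) : ‖(s : ℝ) * r‖ ≤ |r| := by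
  cases s <;> simp

theorem summable_sign_mul (s : ι → SignType) (x : lp (fun _ : ι => ℝ) 1) :
    Summable fun i => (s i : ℝ) * x i :=
  Summable.of_norm_bounded (summable_abs_apply x) fun i => norm_sign_mul_le_abs (s i) (x i)

/-- The functional `x ↦ ∑ i, s i * x i` on `ℓ¹` defined by a family of signs; these functionals
form a compact set that determines the norm. -/
noncomputable def signedSum (s : ι → SignType) : StrongDual ℝ (lp (fun _ : ι => ℝ) 1) :=
  LinearMap.mkContinuous
    { toFun := fun x => ∑' i, (s i : ℝ) * x i
      map_add' := fun x y => by
        simp only [lp.coeFn_add, Pi.add_apply, mul_add]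
        exact (summable_sign_mul s x).tsum_add (summable_sign_mul s y)
      map_smul' := fun c x => by
        simp only [lp.coeFn_smul, Pi.smul_apply, smul_eq_mul, RingHom.id_apply, mul_left_comm _ c]
        exact tsum_mul_left } 1 fun x => by
    rw [one_mul, lp_one_norm_eq_tsum_abs]
    exact tsum_of_norm_bounded (summable_abs_apply x).hasSum
      fun i => norm_sign_mul_le_abs (s i) (x i)

theorem signedSum_apply (s : ι → SignType) (x : lp (fun _ : ι => ℝ) 1) :
    signedSum s x = ∑' i, (s i : ℝ) * x i := rfl

theorem continuous_signedSum_apply (x : lp (fun _ : ι => ℝ) 1) :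
    Continuous fun s : ι → SignType => signedSum s x := by
  refine continuous_tsum (fun i => ?_) (summable_abs_apply x)
    fun i s => norm_sign_mul_le_abs (s i) (x i)
  exact ((continuous_of_discreteTopology (f := ((↑) : SignType → ℝ))).comp
    (continuous_apply i)).mul continuous_const

theorem exists_finset_subset_of_mem_interior {S : Set (ι → SignType)} {s : ι → SignType}
    (hs : s ∈ interior S) : ∃ t : Finset ι, ∀ s', (∀ i ∈ t, s' i = s i) → s' ∈ S := by
  obtain ⟨t, u, hu, hS⟩ := (isOpen_pi_iff.1 isOpen_interior) s hs
  refine ⟨t, fun s' h => interior_subset (hS fun i hi => ?_)⟩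
  rw [h i hi]
  exact (hu i hi).2

theorem norm_le_signedSum_add [DecidableEq ι] (s : ι → SignType) (t : Finset ι)
    (x : lp (fun _ : ι => ℝ) 1) :
    ‖x‖ ≤ signedSum (t.piecewise s fun i => SignType.sign (x i)) x + 2 * ∑ i ∈ t, |x i| := by
  have hle (i : ι) : |x i| ≤ (t.piecewise s (fun i => SignType.sign (x i)) i : ℝ) * x i +
      (t : Set ι).indicator (fun i => 2 * |x i|) i := by
    by_cases hi : i ∈ t
    · have := neg_le_of_abs_le (norm_sign_mul_le_abs (s i) (x i))
      simp only [Finset.piecewise_eq_of_mem _ _ _ hi, Set.indicator_of_mem (Finset.mem_coe.2 hi)]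
      linarith
    · simp [hi]
  have hsum := summable_sign_mul (t.piecewise s fun i => SignType.sign (x i)) x
  have hind : HasSum ((t : Set ι).indicator fun i => 2 * |x i|) (∑ i ∈ t, 2 * |x i|) :=
    hasSum_subtype_iff_indicator.1 (t.hasSum _)
  rw [lp_one_norm_eq_tsum_abs, signedSum_apply, Finset.mul_sum]
  exact hasSum_le hle (summable_abs_apply x).hasSum (hsum.hasSum.add hind)

theorem exists_signs_eventually_abs_signedSum_le {x : ℕ → lp (fun _ : ι => ℝ) 1}
    (hx : WeakTendsto x atTop 0) {ε : ℝ} (hε : 0 < ε) :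
    ∃ (s : ι → SignType) (t : Finset ι) (N : ℕ), ∀ s', (∀ i ∈ t, s' i = s i) →
      ∀ n ≥ N, |signedSum s' (x n)| ≤ ε := by
  let S (N : ℕ) : Set (ι → SignType) := {s | ∀ n ≥ N, |signedSum s (x n)| ≤ ε}
  have hclosed (N : ℕ) : IsClosed (S N) := by
    simp only [S, Set.ofPred_forall]
    exact isClosed_iInter fun n => isClosed_iInter fun _ =>
      isClosed_le (continuous_signedSum_apply _).abs continuous_const
  have hcover : ⋃ N, S N = Set.univ := by
    refine Set.eq_univ_of_forall fun s => Set.mem_iUnion.2 ?_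
    have h := (weakTendsto_iff.1 hx (signedSum s)).abs
    rw [map_zero, abs_zero] at h
    exact eventually_atTop.1 (h.eventually (ge_mem_nhds hε))
  obtain ⟨N, s, hs⟩ := nonempty_interior_of_iUnion_of_closed hclosed hcover
  obtain ⟨t, ht⟩ := exists_finset_subset_of_mem_interior hs
  exact ⟨s, t, N, ht⟩

theorem WeakTendsto.tendsto_apply_lp {α : Type*} {l : Filter α}
    {x : α → lp (fun _ : ι => ℝ) 1} {a : lp (fun _ : ι => ℝ) 1} (hx : WeakTendsto x l a) (i : ι) :
    Tendsto (fun n => x n i) l (𝓝 (a i)) :=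
  weakTendsto_iff.1 hx (lp.evalCLM ℝ (fun _ : ι => ℝ) 1 i)

theorem WeakTendsto.tendsto_of_lp_one {x : ℕ → lp (fun _ : ι => ℝ) 1}
    {a : lp (fun _ : ι => ℝ) 1} (hx : WeakTendsto x atTop a) : Tendsto x atTop (𝓝 a) := by
  classical
  have hxa : WeakTendsto (fun n => x n - a) atTop 0 := by simpa using hx.sub_const a
  rw [tendsto_iff_norm_sub_tendsto_zero]
  refine tendsto_order.2 ⟨fun r hr => Eventually.of_forall fun n => hr.trans_le (norm_nonneg _),
    fun ε hε => ?_⟩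
  obtain ⟨s, t, N, h⟩ := exists_signs_eventually_abs_signedSum_le hxa (half_pos hε)
  have ht : Tendsto (fun n => 2 * ∑ i ∈ t, |(x n - a) i|) atTop (𝓝 0) := by
    simpa using (tendsto_finsetSum t fun i _ => (hxa.tendsto_apply_lp i).abs).const_mul 2
  filter_upwards [eventually_ge_atTop N, ht.eventually (gt_mem_nhds (half_pos hε))] with n hn hnt
  have h1 := norm_le_signedSum_add s t (x n - a)
  have h2 := h (t.piecewise s fun i => SignType.sign ((x n - a) i))
    (fun i hi => t.piecewise_eq_of_mem _ _ hi) n hn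
  linarith [le_abs_self (signedSum (t.piecewise s fun i => SignType.sign ((x n - a) i)) (x n - a))]

theorem eventually_abs_apply_lt_of_totallyBounded {K : Set (lp (fun _ : ι => ℝ) 1)}
    (hK : TotallyBounded K) {ε : ℝ} (hε : 0 < ε) :
    ∀ᶠ i in cofinite, ∀ x ∈ K, |x i| < ε := by
  obtain ⟨t, ht, hKt⟩ := Metric.totallyBounded_iff.1 hK (ε / 2) (half_pos hε)
  have hsmall : ∀ᶠ i in cofinite, ∀ y ∈ t, |y i| < ε / 2 := (eventually_all_finite ht).2
    fun y _ => (summable_abs_apply y).tendsto_cofinite_zero.eventually (gt_mem_nhds (half_pos hε))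
  filter_upwards [hsmall] with i hi x hx
  obtain ⟨y, hy, hxy⟩ := Set.mem_iUnion₂.1 (hKt hx)
  have hdist : |x i - y i| < ε / 2 :=
    (lp.norm_apply_le_norm one_ne_zero (x - y) i).trans_lt (mem_ball_iff_norm.1 hxy)
  linarith [abs_sub_abs_le_abs_sub (x i) (y i), hi y hy]

theorem WeakTendsto.tendsto_diagonal_lp_one {x : ℕ → lp (fun _ : ℕ => ℝ) 1}
    {a : lp (fun _ : ℕ => ℝ) 1} (hx : WeakTendsto x atTop a) (m : ℕ → ℕ) :
    Tendsto (fun k => x (m k) k) atTop (𝓝 0) := by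
  refine tendsto_zero_iff_abs_tendsto_zero _ |>.2 ?_
  refine tendsto_order.2 ⟨fun r hr => Eventually.of_forall fun k => hr.trans_le (abs_nonneg _),
    fun ε hε => ?_⟩
  have hK := eventually_abs_apply_lt_of_totallyBounded
    hx.tendsto_of_lp_one.cauchySeq.totallyBounded_range hε
  rw [Nat.cofinite_eq_atTop] at hK
  exact hK.mono fun k hk => hk _ ⟨m k, rfl⟩

theorem exists_clm_lp_one_of_sum_abs_le {E : Type*} [NormedAddCommGroup E] [NormedSpace ℝ E]
    {h : ι → StrongDual ℝ E} {C : ℝ} (hh : ∀ x, ∀ s : Finset ι, ∑ i ∈ s, |h i x| ≤ C * ‖x‖) :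
    ∃ T : E →L[ℝ] lp (fun _ : ι => ℝ) 1, ∀ x i, T x i = h i x := by
  have hmem (x : E) : Memℓp (fun i => h i x) 1 :=
    memℓp_gen' fun s => by simpa using hh x s
  let T : E →ₗ[ℝ] lp (fun _ : ι => ℝ) 1 :=
    { toFun := fun x => ⟨fun i => h i x, hmem x⟩
      map_add' := fun x y => lp.ext (funext fun i => map_add (h i) x y)
      map_smul' := fun c x => lp.ext (funext fun i => map_smul (h i) c x) }
  refine ⟨T.mkContinuous C fun x => ?_, fun x i => rfl⟩
  rw [lp_one_norm_eq_tsum_abs]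
  exact (summable_abs_apply (T x)).tsum_le_of_sum_le (hh x)

theorem WeakTendsto.tendsto_dual_of_sum_abs_le {E : Type*} [NormedAddCommGroup E]
    [NormedSpace ℝ E] {y : ℕ → E} {b : E} (hy : WeakTendsto y atTop b) {h : ℕ → StrongDual ℝ E}
    {C : ℝ} (hh : ∀ x, ∀ s : Finset ℕ, ∑ k ∈ s, |h k x| ≤ C * ‖x‖) (m : ℕ → ℕ) :
    Tendsto (fun k => h k (y (m k))) atTop (𝓝 0) := by
  obtain ⟨T, hT⟩ := exists_clm_lp_one_of_sum_abs_le hh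
  simpa only [hT] using (hy.map_clm T).tendsto_diagonal_lp_one m

end Schur

section LatticeGroup

open scoped Pointwise

variable {E : Type*} [AddCommGroup E] [Lattice E] [IsOrderedAddMonoid E]

theorem add_inf_le_inf_add_inf {a b c : E} (ha : 0 ≤ a) (hb : 0 ≤ b) (hc : 0 ≤ c) :
    (a + b) ⊓ c ≤ a ⊓ c + b ⊓ c := by
  rw [add_inf, inf_add, inf_add]
  refine le_inf (le_inf inf_le_left ?_) (le_inf ?_ ?_)
  · exact inf_le_right.trans (le_add_of_nonneg_right hb)
  · exact inf_le_right.trans (le_add_of_nonneg_left ha)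
  · exact inf_le_right.trans (le_add_of_nonneg_left hc)

theorem sum_inf_eq_zero {ι : Type*} {w : ι → E} (hw : ∀ i, 0 ≤ w i) {c : E} (hc : 0 ≤ c)
    {s : Finset ι} (hdisj : ∀ i ∈ s, w i ⊓ c = 0) : (∑ i ∈ s, w i) ⊓ c = 0 := by
  classical
  induction s using Finset.induction_on with
  | empty => simpa using hc
  | insert i s hi ih =>
    rw [Finset.forall_mem_insert] at hdisj
    have hsum : 0 ≤ ∑ k ∈ s, w k := Finset.sum_nonneg fun k _ => hw k
    rw [Finset.sum_insert hi]
    refine le_antisymm ?_ (le_inf (add_nonneg (hw i) hsum) hc)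
    simpa [hdisj.1, ih hdisj.2] using add_inf_le_inf_add_inf (hw i) hsum hc

theorem sum_le_of_pairwise_inf_eq_zero {ι : Type*} {w : ι → E} {x : E} (hx : 0 ≤ x)
    (hw : ∀ i, 0 ≤ w i) (hwx : ∀ i, w i ≤ x) (hdisj : Pairwise fun i j => w i ⊓ w j = 0)
    (s : Finset ι) : ∑ i ∈ s, w i ≤ x := by
  classical
  induction s using Finset.induction_on with
  | empty => simpa
  | insert i s hi ih =>
    have hinf : (∑ j ∈ s, w j) ⊓ w i = 0 :=
      sum_inf_eq_zero hw (hw i) fun j hj => hdisj (ne_of_mem_of_not_mem hj hi)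
    rw [Finset.sum_insert hi, ← inf_add_sup, inf_comm, hinf, zero_add]
    exact sup_le (hwx i) ih

theorem abs_inf_sub_inf_le_add (a b c d : E) : |a ⊓ c - b ⊓ d| ≤ |a - b| + |c - d| :=
  calc |a ⊓ c - b ⊓ d| ≤ |a ⊓ c - b ⊓ c| + |c ⊓ b - d ⊓ b| := by
        simpa only [inf_comm b, sub_add_sub_cancel] using abs_add_le (a ⊓ c - b ⊓ c) (b ⊓ c - b ⊓ d)
    _ ≤ |a - b| + |c - d| :=
      add_le_add (abs_inf_sub_inf_le_abs a b c) (abs_inf_sub_inf_le_abs c d b)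

theorem abs_sup_sub_sup_le_add (a b c d : E) : |a ⊔ c - b ⊔ d| ≤ |a - b| + |c - d| :=
  calc |a ⊔ c - b ⊔ d| ≤ |a ⊔ c - b ⊔ c| + |c ⊔ b - d ⊔ b| := by
        simpa only [sup_comm b, sub_add_sub_cancel] using abs_add_le (a ⊔ c - b ⊔ c) (b ⊔ c - b ⊔ d)
    _ ≤ |a - b| + |c - d| :=
      add_le_add (abs_sup_sub_sup_le_abs a b c) (abs_sup_sub_sup_le_abs c d b)

theorem Icc_add_Icc_of_latticeOrdered {a b c d : E} (hab : a ≤ b) (hcd : c ≤ d) :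
    Set.Icc a b + Set.Icc c d = Set.Icc (a + c) (b + d) := by
  refine (Set.Icc_add_Icc_subset _ _ _ _).antisymm fun z ⟨hz, hz'⟩ => ?_
  refine ⟨b ⊓ (z - c), ⟨le_inf hab (le_sub_iff_add_le.2 hz), inf_le_left⟩, z - b ⊓ (z - c), ?_,
    add_sub_cancel _ _⟩
  rw [sub_inf, sub_sub_cancel]
  exact ⟨le_sup_right, sup_le (sub_le_iff_le_add'.2 hz') hcd⟩

theorem posPart_add_add_negPart_add (x y : E) :
    (x + y)⁺ + (x⁻ + y⁻) = x⁺ + y⁺ + (x + y)⁻ := by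
  rw [← sub_eq_sub_iff_add_eq_add, posPart_sub_negPart, add_sub_add_comm, posPart_sub_negPart,
    posPart_sub_negPart]

theorem exists_addMonoidHom_eq_of_nonneg {F : Type*} [AddCommGroup F] {q : E → F}
    (hq : ∀ x y, 0 ≤ x → 0 ≤ y → q (x + y) = q x + q y) :
    ∃ g : E →+ F, ∀ x, 0 ≤ x → g x = q x := by
  have hp (x : E) : 0 ≤ x⁺ := posPart_nonneg x
  have hn (x : E) : 0 ≤ x⁻ := negPart_nonneg x
  refine ⟨AddMonoidHom.mk' (fun x => q x⁺ - q x⁻) fun x y => ?_, fun x hx => ?_⟩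
  · have h := congrArg q (posPart_add_add_negPart_add x y)
    rw [hq _ _ (hp _) (add_nonneg (hn x) (hn y)), hq _ _ (hn x) (hn y),
      hq _ _ (add_nonneg (hp x) (hp y)) (hn _), hq _ _ (hp x) (hp y)] at h
    rw [sub_add_sub_comm]
    exact sub_eq_sub_iff_add_eq_add.2 h
  · have h0 : q 0 = 0 := by simpa using hq 0 0 le_rfl le_rfl
    simp [posPart_of_nonneg hx, negPart_of_nonneg hx, h0]

end LatticeGroup

theorem abs_apply_le_apply_abs {E G : Type*} [AddCommGroup E] [Lattice E]
    [AddCommGroup G] [Lattice G] [IsOrderedAddMonoid G] {F : Type*} [FunLike F E G]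
    [AddMonoidHomClass F E G] {g : F} (hg : Monotone g) (x : E) : |g x| ≤ g |x| :=
  abs_le'.2 ⟨hg (le_abs_self x), by rw [← map_neg]; exact hg (neg_le_abs x)⟩

theorem nonneg_apply_of_monotone {E G : Type*} [AddCommGroup E] [Preorder E]
    [AddCommGroup G] [Preorder G] {F : Type*} [FunLike F E G] [AddMonoidHomClass F E G] {g : F}
    (hg : Monotone g) {x : E} (hx : 0 ≤ x) : 0 ≤ g x := by
  simpa using hg hx

section VectorLattice

variable {E : Type*} [AddCommGroup E] [Lattice E] [Module ℝ E] [IsOrderedModule ℝ E]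

theorem smul_inf_of_pos {c : ℝ} (hc : 0 < c) (a b : E) : c • (a ⊓ b) = c • a ⊓ c • b :=
  (OrderIso.smulRight hc).map_inf a b

theorem smul_sup_of_pos {c : ℝ} (hc : 0 < c) (a b : E) : c • (a ⊔ b) = c • a ⊔ c • b :=
  (OrderIso.smulRight hc).map_sup a b

theorem abs_smul_of_pos {c : ℝ} (hc : 0 < c) (a : E) : |c • a| = c • |a| := by
  rw [abs, abs, smul_sup_of_pos hc, smul_neg]

theorem abs_smul_eq_abs_smul_abs [IsOrderedAddMonoid E] (c : ℝ) (a : E) : |c • a| = |c| • |a| := by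
  rcases lt_trichotomy c 0 with hc | rfl | hc
  · rw [← abs_neg, ← neg_smul, abs_smul_of_pos (neg_pos.2 hc), abs_of_neg hc]
  · simp
  · rw [abs_smul_of_pos hc, abs_of_pos hc]

variable [IsOrderedAddMonoid E]

theorem posPart_sub_smul_inf_posPart_sub_smul {x y : E} {c d : ℝ} (hd : 0 < d) (hd1 : d ≤ 1)
    (hcd : 1 ≤ c * d) (hy : 0 ≤ y) : (x - c • y)⁺ ⊓ (y - d • x)⁺ = 0 := by
  have hle : (y - d • x)⁺ ≤ (x - c • y)⁻ := calc
    (y - d • x)⁺ ≤ (d • (c • y - x))⁺ := posPart_mono <| by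
      rw [smul_sub, smul_smul, mul_comm]
      exact sub_le_sub_right (le_smul_of_one_le_left hy hcd) _
    _ = d • (x - c • y)⁻ := by
      rw [negPart_def, posPart_def, neg_sub, smul_sup_of_pos hd, smul_zero]
    _ ≤ (x - c • y)⁻ := smul_le_of_le_one_left (negPart_nonneg _) hd1
  refine le_antisymm ?_ (le_inf (posPart_nonneg _) (posPart_nonneg _))
  exact (inf_le_inf_left _ hle).trans_eq (posPart_inf_negPart_eq_zero _)

theorem abs_smul_inf_smul_le {c s t : ℝ} (hc : c ≠ 0) (hst : s ≤ |c| * t) {v : E} (hv : 0 ≤ v)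
    (x : E) : |c • x| ⊓ s • v ≤ |c| • (|x| ⊓ t • v) := by
  rw [smul_inf_of_pos (abs_pos.2 hc), abs_smul_eq_abs_smul_abs, smul_smul]
  exact inf_le_inf_left _ (smul_le_smul_of_nonneg_right hst hv)

/-- The disjoint sequence cut out of a positive sequence `z`: subtracting a large multiple of the
previous terms makes the `k`-th term disjoint from the earlier ones, up to an error which is
absorbed by the small multiple of an element `Y` that dominates every `2⁻ᵏ • z k`. -/
noncomputable def disjointification (z : ℕ → E) (Y : E) (k : ℕ) : E :=
  (z k - (4 : ℝ) ^ k • ∑ i ∈ Finset.range k, z i - ((1 : ℝ) / 2) ^ k • Y)⁺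

section Disjointification

variable {z : ℕ → E} {Y : E}

theorem disjointification_le_posPart (hY : 0 ≤ Y) (k : ℕ) :
    disjointification z Y k ≤ (z k - (4 : ℝ) ^ k • ∑ i ∈ Finset.range k, z i)⁺ :=
  posPart_mono (sub_le_self _ (smul_nonneg (by positivity) hY))

theorem posPart_le_disjointification_add (hY : 0 ≤ Y) (k : ℕ) :
    (z k - (4 : ℝ) ^ k • ∑ i ∈ Finset.range k, z i)⁺ ≤
      disjointification z Y k + ((1 : ℝ) / 2) ^ k • Y :=
  sup_le (sub_le_iff_le_add.1 (le_posPart _))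
    (add_nonneg (posPart_nonneg _) (smul_nonneg (by positivity) hY))

theorem disjointification_le (hz : ∀ k, 0 ≤ z k) (hY : 0 ≤ Y) (k : ℕ) :
    disjointification z Y k ≤ z k := by
  refine (disjointification_le_posPart hY k).trans (sup_le (sub_le_self _ ?_) (hz k))
  exact smul_nonneg (by positivity) (Finset.sum_nonneg fun i _ => hz i)

theorem disjointification_inf_of_lt (hz : ∀ k, 0 ≤ z k)
    (hzY : ∀ k, ((1 : ℝ) / 2) ^ k • z k ≤ Y) {i k : ℕ} (hik : i < k) :
    disjointification z Y k ⊓ disjointification z Y i = 0 := by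
  have hY : 0 ≤ Y := (hz 0).trans (by simpa using hzY 0)
  have hk : disjointification z Y k ≤ (z k - (4 : ℝ) ^ k • z i)⁺ := by
    refine (disjointification_le_posPart hY k).trans (posPart_mono (sub_le_sub_left ?_ _))
    exact smul_le_smul_of_nonneg_left
      (Finset.single_le_sum (fun n _ => hz n) (Finset.mem_range.2 hik)) (by positivity)
  have hi : disjointification z Y i ≤ (z i - ((1 : ℝ) / 2) ^ (i + k) • z k)⁺ := by
    refine posPart_mono (sub_le_sub (sub_le_self _ ?_) ?_)
    · exact smul_nonneg (by positivity) (Finset.sum_nonneg fun n _ => hz n)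
    · rw [pow_add, mul_smul]
      exact smul_le_smul_of_nonneg_left (hzY k) (by positivity)
  have hpow : (1 : ℝ) ≤ 4 ^ k * (1 / 2) ^ (i + k) := by
    rw [show (4 : ℝ) = 2 ^ 2 by norm_num, ← pow_mul, one_div, inv_pow, ← div_eq_mul_inv,
      one_le_div (by positivity)]
    exact pow_le_pow_right₀ one_le_two (by omega)
  refine le_antisymm ?_ (le_inf (posPart_nonneg _) (posPart_nonneg _))
  refine (inf_le_inf hk hi).trans_eq (posPart_sub_smul_inf_posPart_sub_smul (by positivity)
    (pow_le_one₀ (by norm_num) (by norm_num)) hpow (hz i))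

theorem pairwise_disjointification_inf_eq_zero (hz : ∀ k, 0 ≤ z k)
    (hzY : ∀ k, ((1 : ℝ) / 2) ^ k • z k ≤ Y) :
    Pairwise fun i j => disjointification z Y i ⊓ disjointification z Y j = 0 := by
  intro i j hij
  rcases hij.lt_or_gt with h | h
  · rw [inf_comm]
    exact disjointification_inf_of_lt hz hzY h
  · exact disjointification_inf_of_lt hz hzY h

end Disjointification

end VectorLattice

theorem exists_seq_eq_apply_sum_range {M : Type*} [AddCommMonoid M] (F : ℕ → M → M) :
    ∃ z : ℕ → M, ∀ k, z k = F k (∑ i ∈ Finset.range k, z i) := by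
  let S (k : ℕ) : M := Nat.rec 0 (fun k s => s + F k s) k
  have hS (k : ℕ) : S k = ∑ i ∈ Finset.range k, F i (S i) := by
    induction k with
    | zero => rfl
    | succ k ih => rw [Finset.sum_range_succ, ← ih]
  exact ⟨fun k => F k (S k), fun k => by rw [← hS]⟩

section Component

theorem bddAbove_range_apply_abs_inf_smul {E : Type*} [AddCommGroup E] [Lattice E] [Module ℝ E]
    {f : E →ₗ[ℝ] ℝ} (hf : Monotone f) (v x : E) :
    BddAbove (Set.range fun j : ℕ => f (|x| ⊓ ((j : ℝ) + 1) • v)) :=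
  ⟨f |x|, by rintro _ ⟨j, rfl⟩; exact hf inf_le_left⟩

variable {E : Type*} [AddCommGroup E] [Lattice E] [IsOrderedAddMonoid E] [Module ℝ E]
  [IsOrderedModule ℝ E] {f : E →ₗ[ℝ] ℝ} {v : E}

/-- The seminorm `x ↦ f_v |x|`, where `f_v` is the component of the positive functional `f` carried
by `v`, that is, `f_v x = sup_j f (x ⊓ j • v)` for `x ≥ 0`. -/
noncomputable def componentSeminorm (hf : Monotone f) (hv : 0 ≤ v) : Seminorm ℝ E :=
  Seminorm.ofSMulLE (fun x => ⨆ j : ℕ, f (|x| ⊓ ((j : ℝ) + 1) • v))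
    (by simp [inf_eq_left.2 (smul_nonneg (Nat.cast_add_one_pos _).le hv)])
    (fun x y => ciSup_le fun j => by
      refine le_trans ?_ (add_le_add (le_ciSup (bddAbove_range_apply_abs_inf_smul hf v x) j)
        (le_ciSup (bddAbove_range_apply_abs_inf_smul hf v y) j))
      rw [← map_add]
      refine hf ((inf_le_inf_right _ (abs_add_le x y)).trans ?_)
      exact add_inf_le_inf_add_inf (abs_nonneg x) (abs_nonneg y) (smul_nonneg (by positivity) hv))
    fun c x => ciSup_le fun j => by
      rcases eq_or_ne c 0 with rfl | hc
      · simpa using hf (inf_le_left : |(0 : ℝ) • x| ⊓ ((j : ℝ) + 1) • v ≤ |(0 : ℝ) • x|)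
      obtain ⟨m, hm⟩ := exists_nat_ge (((j : ℝ) + 1) / |c|)
      have hjm : (j : ℝ) + 1 ≤ |c| * ((m : ℝ) + 1) :=
        (div_le_iff₀' (abs_pos.2 hc)).1 (hm.trans (lt_add_one _).le)
      calc f (|c • x| ⊓ ((j : ℝ) + 1) • v)
          ≤ f (|c| • (|x| ⊓ ((m : ℝ) + 1) • v)) := hf (abs_smul_inf_smul_le hc hjm hv x)
        _ = ‖c‖ * f (|x| ⊓ ((m : ℝ) + 1) • v) := by rw [map_smul, smul_eq_mul, Real.norm_eq_abs]
        _ ≤ _ := mul_le_mul_of_nonneg_left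
          (le_ciSup (bddAbove_range_apply_abs_inf_smul hf v x) m) (norm_nonneg c)

theorem componentSeminorm_apply (hf : Monotone f) (hv : 0 ≤ v) (x : E) :
    componentSeminorm hf hv x = ⨆ j : ℕ, f (|x| ⊓ ((j : ℝ) + 1) • v) := rfl

theorem componentSeminorm_le (hf : Monotone f) (hv : 0 ≤ v) (x : E) :
    componentSeminorm hf hv x ≤ f |x| :=
  ciSup_le fun _ => hf inf_le_left

theorem le_componentSeminorm (hf : Monotone f) (hv : 0 ≤ v) {x : E} (hvx : v ≤ |x|) :
    f v ≤ componentSeminorm hf hv x := by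
  simpa [componentSeminorm_apply, inf_eq_right.2 hvx] using
    le_ciSup (bddAbove_range_apply_abs_inf_smul hf v x) 0

theorem tendsto_componentSeminorm (hf : Monotone f) (hv : 0 ≤ v) (x : E) :
    Tendsto (fun j : ℕ => f (|x| ⊓ ((j : ℝ) + 1) • v)) atTop (𝓝 (componentSeminorm hf hv x)) := by
  refine tendsto_atTop_ciSup (fun i j hij => hf (inf_le_inf_left _ ?_))
    (bddAbove_range_apply_abs_inf_smul hf v x)
  exact smul_le_smul_of_nonneg_right (by gcongr) hv

theorem sum_componentSeminorm_le {ι : Type*} {v : ι → E} (hf : Monotone f) (hv : ∀ i, 0 ≤ v i)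
    (hdisj : Pairwise fun i j => v i ⊓ v j = 0) (x : E) (s : Finset ι) :
    ∑ i ∈ s, componentSeminorm hf (hv i) x ≤ f |x| := by
  refine le_of_tendsto (tendsto_finsetSum s fun i _ => tendsto_componentSeminorm hf (hv i) x)
    (Eventually.of_forall fun j => ?_)
  have hj : (0 : ℝ) < (j : ℝ) + 1 := by positivity
  have hnonneg (i : ι) : 0 ≤ |x| ⊓ ((j : ℝ) + 1) • v i :=
    le_inf (abs_nonneg x) (smul_nonneg hj.le (hv i))
  rw [← map_sum]
  refine hf (sum_le_of_pairwise_inf_eq_zero (abs_nonneg x) hnonneg (fun _ => inf_le_left)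
    (fun i k hik => le_antisymm ?_ (le_inf (hnonneg i) (hnonneg k))) s)
  refine (inf_le_inf inf_le_right inf_le_right).trans_eq ?_
  rw [← smul_inf_of_pos hj, hdisj hik, smul_zero]

end Component

theorem exists_dual_eq_seminorm {E : Type*} [NormedAddCommGroup E] [NormedSpace ℝ E]
    {p : Seminorm ℝ E} (hp : Continuous p) (y : E) :
    ∃ h : StrongDual ℝ E, h y = p y ∧ ∀ x, |h x| ≤ p x := by
  rcases eq_or_ne y 0 with rfl | hy
  · exact ⟨0, by simp, fun x => by simp⟩
  let h₀ : E →ₗ.[ℝ] ℝ := LinearPMap.mkSpanSingleton y (p y) hy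
  have hle (x : h₀.domain) : h₀ x ≤ p x := by
    obtain ⟨x, hx⟩ := x
    obtain ⟨c, rfl⟩ := Submodule.mem_span_singleton.1 hx
    rw [LinearPMap.mkSpanSingleton'_apply, map_smul_eq_mul]
    exact mul_le_mul_of_nonneg_right (le_abs_self c) (apply_nonneg p y)
  obtain ⟨h, hh, hhp⟩ := Module.Dual.exists_continuous_extension_of_le_seminorm_real
    h₀.domain h₀.toFun hp hle
  exact ⟨h, (hh ⟨y, Submodule.mem_span_singleton_self y⟩).trans
    (LinearPMap.mkSpanSingleton_apply ℝ ℝ hy (p y)), hhp⟩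

section NormedLattice

open scoped Pointwise

variable {E ι : Type*} [NormedAddCommGroup E] [NormedSpace ℝ E] [Lattice E]

/-- The modulus `|φ| x = sup {φ y : -x ≤ y ≤ x}` of a functional `φ` on the positive cone; off the
cone the interval may be empty and the value is junk. -/
noncomputable def coneModulus (φ : StrongDual ℝ E) (x : E) : ℝ :=
  sSup (φ '' Set.Icc (-x) x)

variable [IsOrderedAddMonoid E] [HasSolidNorm E]

theorem apply_abs_le_opNorm_mul_norm (f : StrongDual ℝ E) (x : E) : f |x| ≤ ‖f‖ * ‖x‖ := by
  simpa only [norm_abs_eq_norm] using (le_abs_self _).trans (f.le_opNorm |x|)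

theorem apply_le_of_mem_Icc_neg (φ : StrongDual ℝ E) {x y : E} (hy : y ∈ Set.Icc (-x) x) :
    φ y ≤ ‖φ‖ * ‖x‖ := by
  have hyx : |y| ≤ x := abs_le'.2 ⟨hy.2, neg_le.1 hy.1⟩
  refine (le_abs_self _).trans ((φ.le_opNorm y).trans ?_)
  gcongr
  exact norm_le_norm_of_abs_le_abs (hyx.trans (le_abs_self x))

theorem bddAbove_image_Icc_neg (φ : StrongDual ℝ E) (x : E) :
    BddAbove (φ '' Set.Icc (-x) x) :=
  ⟨‖φ‖ * ‖x‖, Set.forall_mem_image.2 fun _ hy => apply_le_of_mem_Icc_neg φ hy⟩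

theorem le_coneModulus (φ : StrongDual ℝ E) {x y : E} (hy : y ∈ Set.Icc (-x) x) :
    φ y ≤ coneModulus φ x :=
  le_csSup (bddAbove_image_Icc_neg φ x) (Set.mem_image_of_mem φ hy)

theorem abs_apply_le_coneModulus_abs (φ : StrongDual ℝ E) (x : E) : |φ x| ≤ coneModulus φ |x| :=
  abs_le'.2 ⟨le_coneModulus φ ⟨neg_le.1 (neg_le_abs x), le_abs_self x⟩, by
    rw [← map_neg]
    exact le_coneModulus φ ⟨neg_le_neg (le_abs_self x), neg_le_abs x⟩⟩

theorem coneModulus_nonneg (φ : StrongDual ℝ E) {x : E} (hx : 0 ≤ x) : 0 ≤ coneModulus φ x := by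
  simpa using le_coneModulus φ (Set.mem_Icc.2 ⟨neg_nonpos.2 hx, hx⟩)

theorem coneModulus_le (φ : StrongDual ℝ E) {x : E} (hx : 0 ≤ x) :
    coneModulus φ x ≤ ‖φ‖ * ‖x‖ :=
  csSup_le ((Set.nonempty_Icc.2 (neg_le_self hx)).image φ)
    (Set.forall_mem_image.2 fun _ hy => apply_le_of_mem_Icc_neg φ hy)

theorem coneModulus_add (φ : StrongDual ℝ E) {x y : E} (hx : 0 ≤ x) (hy : 0 ≤ y) :
    coneModulus φ (x + y) = coneModulus φ x + coneModulus φ y := by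
  rw [coneModulus, neg_add, ← Icc_add_Icc_of_latticeOrdered (neg_le_self hx) (neg_le_self hy),
    Set.image_add]
  exact csSup_add ((Set.nonempty_Icc.2 (neg_le_self hx)).image φ) (bddAbove_image_Icc_neg φ x)
    ((Set.nonempty_Icc.2 (neg_le_self hy)).image φ) (bddAbove_image_Icc_neg φ y)

theorem exists_monotone_dual_abs_apply_le (φ : StrongDual ℝ E) :
    ∃ f : StrongDual ℝ E, Monotone f ∧ ∀ x, |φ x| ≤ f |x| := by
  obtain ⟨g, hg⟩ := exists_addMonoidHom_eq_of_nonneg fun x y => coneModulus_add φ (x := x) (y := y)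
  have hmono : Monotone g := (monotone_iff_map_nonneg g).2 fun x hx =>
    (coneModulus_nonneg φ hx).trans_eq (hg x hx).symm
  have hcont : Continuous g := AddMonoidHomClass.continuous_of_bound g ‖φ‖ fun x => calc
    |g x| ≤ g |x| := abs_apply_le_apply_abs hmono x
    _ = coneModulus φ |x| := hg _ (abs_nonneg x)
    _ ≤ ‖φ‖ * ‖x‖ := (coneModulus_le φ (abs_nonneg x)).trans_eq (by rw [norm_abs_eq_norm])
  exact ⟨g.toRealLinearMap hcont, hmono, fun x =>
    (abs_apply_le_coneModulus_abs φ x).trans_eq (hg _ (abs_nonneg x)).symm⟩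

variable {x y : ι → E} {l : Filter ι} {a b : E}

theorem weakTendsto_of_tendsto_apply_abs
    (h : ∀ f : StrongDual ℝ E, Monotone f → Tendsto (fun i => f |x i - a|) l (𝓝 0)) :
    WeakTendsto x l a := by
  refine weakTendsto_iff.2 fun φ => tendsto_sub_nhds_zero_iff.1 ?_
  obtain ⟨f, hf, hφ⟩ := exists_monotone_dual_abs_apply_le φ
  exact squeeze_zero_norm (fun i => by simpa using hφ (x i - a)) (h f hf)

theorem WeakTendsto.of_abs_sub_le (hy : WeakTendsto y l 0) (hxy : ∀ i, |x i - a| ≤ y i) :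
    WeakTendsto x l a :=
  weakTendsto_of_tendsto_apply_abs fun f hf =>
    squeeze_zero (fun i => nonneg_apply_of_monotone hf (abs_nonneg _)) (fun i => hf (hxy i))
      (by simpa using weakTendsto_iff.1 hy f)

theorem weaklySeqContinuousLatticeOps_iff :
    WeaklySeqContinuousLatticeOps E ↔
      ∀ x : ℕ → E, WeakTendsto x atTop 0 → WeakTendsto (fun n => |x n|) atTop 0 := by
  refine ⟨fun h x hx => ?_, fun h x y a b hx hy => ?_⟩
  · simpa [abs] using (h x _ 0 _ hx hx.neg).1
  · have hsum : WeakTendsto (fun n => |x n - a| + |y n - b|) atTop 0 := by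
      simpa using (h _ (by simpa using hx.sub_const a)).add (h _ (by simpa using hy.sub_const b))
    exact ⟨hsum.of_abs_sub_le fun n => abs_sup_sub_sup_le_add _ _ _ _,
      hsum.of_abs_sub_le fun n => abs_inf_sub_inf_le_add _ _ _ _⟩

theorem WeaklySeqContinuousLatticeOps.uawTendsto (h : WeaklySeqContinuousLatticeOps E) {A : Set E}
    (hA : RelativelyWeaklyCompact A) (hxA : ∀ᶠ i in l, x i ∈ A) (hx : WeakTendsto x l a) :
    UawTendsto x l a := by
  have habs : WeakTendsto (fun i => |x i - a|) l 0 :=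
    hA.tendsto_of_seq_tendsto (g := fun z => toWeakSpace ℝ E |z - a|)
      (fun y hy => weaklySeqContinuousLatticeOps_iff.1 h _ (by simpa using hy.sub_const a)) hxA hx
  refine fun u hu => habs.of_abs_sub_le fun i => ?_
  rw [sub_zero, abs_of_nonneg (le_inf (abs_nonneg _) hu)]
  exact inf_le_left

theorem WeakTendsto.tendsto_apply_of_disjoint [IsOrderedModule ℝ E] {y : ℕ → E} {b : E}
    (hy : WeakTendsto y atTop b) {f : StrongDual ℝ E} (hf : Monotone f) {v : ℕ → E}
    (hv : ∀ k, 0 ≤ v k) (hdisj : Pairwise fun i j => v i ⊓ v j = 0) {m : ℕ → ℕ}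
    (hvy : ∀ k, v k ≤ |y (m k)|) : Tendsto (fun k => f (v k)) atTop (𝓝 0) := by
  have hf' : Monotone (f : E →ₗ[ℝ] ℝ) := hf
  have hbound (x : E) (s : Finset ℕ) : ∑ k ∈ s, componentSeminorm hf' (hv k) x ≤ ‖f‖ * ‖x‖ :=
    (sum_componentSeminorm_le hf' hv hdisj x s).trans (apply_abs_le_opNorm_mul_norm f x)
  have hcont (k : ℕ) : Continuous (componentSeminorm hf' (hv k)) :=
    Seminorm.continuous_of_le (q := ‖f‖₊ • normSeminorm ℝ E) (continuous_norm.const_smul ‖f‖₊)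
      fun x => (componentSeminorm_le hf' (hv k) x).trans (apply_abs_le_opNorm_mul_norm f x)
  choose h hhy hh using fun k => exists_dual_eq_seminorm (hcont k) (y (m k))
  refine squeeze_zero (fun k => nonneg_apply_of_monotone hf (hv k))
    (fun k => (le_componentSeminorm hf' (hv k) (hvy k)).trans_eq (hhy k).symm) ?_
  exact hy.tendsto_dual_of_sum_abs_le
    (fun x s => (Finset.sum_le_sum fun k _ => hh k x).trans (hbound x s)) m

end NormedLattice

section AlmostOrderBounded

variable {E ι : Type*} [NormedAddCommGroup E] [NormedSpace ℝ E] [Lattice E] [IsOrderedAddMonoid E]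
  {x : ι → E} {l : Filter ι} {a : E}

/-- `A` is almost order bounded with respect to `f`: up to an `f`-small error, the moduli of its
elements lie below a common `u`. For positive `f` this says that `A` is almost order bounded for the
lattice seminorm `x ↦ f |x|`. -/
def AlmostOrderBounded (f : E → ℝ) (A : Set E) : Prop :=
  ∀ ε > 0, ∃ u, 0 ≤ u ∧ ∀ x ∈ A, f (|x| - u)⁺ ≤ ε

theorem AlmostOrderBounded.tendsto_apply_abs {f : StrongDual ℝ E} {A : Set E}
    (hA : AlmostOrderBounded f A) (hf : Monotone f) (hxA : ∀ᶠ i in l, x i ∈ A)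
    (hx : UawTendsto x l 0) : Tendsto (fun i => f |x i|) l (𝓝 0) := by
  refine Metric.tendsto_nhds.2 fun ε hε => ?_
  obtain ⟨u, hu, hAu⟩ := hA (ε / 2) (half_pos hε)
  have hinf : Tendsto (fun i => f (|x i| ⊓ u)) l (𝓝 0) := by
    simpa using weakTendsto_iff.1 (hx u hu) f
  filter_upwards [hxA, hinf.eventually (gt_mem_nhds (half_pos hε))] with i hi hlt
  rw [Real.dist_0_eq_abs, abs_of_nonneg (nonneg_apply_of_monotone hf (abs_nonneg _))]
  calc f |x i| = f (|x i| ⊓ u) + f (|x i| - u)⁺ := by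
        rw [← map_add, inf_eq_sub_posPart_sub, sub_add_cancel]
    _ < ε := by linarith [hAu _ hi]

variable [HasSolidNorm E] [IsOrderedModule ℝ E] [CompleteSpace E]

theorem exists_forall_half_pow_smul_le {z : ℕ → E}
    (hz : ∀ k, 0 ≤ z k) (hbdd : Bornology.IsBounded (Set.range z)) :
    ∃ Y, ∀ k, ((1 : ℝ) / 2) ^ k • z k ≤ Y := by
  obtain ⟨C, hC⟩ := hbdd.exists_norm_le
  have hsum : Summable fun k => ((1 : ℝ) / 2) ^ k • z k := by
    refine .of_norm_bounded (summable_geometric_two.mul_right C) fun k => ?_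
    rw [norm_smul, norm_pow, Real.norm_of_nonneg one_half_pos.le]
    gcongr
    exact hC _ ⟨k, rfl⟩
  exact ⟨_, fun k => hsum.le_tsum k fun i _ => smul_nonneg (by positivity) (hz i)⟩

theorem almostOrderBounded_of_disjoint {f : StrongDual ℝ E} (hf : Monotone f) {A : Set E}
    (hA : Bornology.IsBounded A)
    (h : ∀ v : ℕ → E, (∀ k, 0 ≤ v k) → (Pairwise fun i j => v i ⊓ v j = 0) →
      (∀ k, ∃ x ∈ A, v k ≤ |x|) → Tendsto (fun k => f (v k)) atTop (𝓝 0)) :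
    AlmostOrderBounded f A := by
  intro ε hε
  by_contra! hcon
  choose! c hcA hc using hcon
  obtain ⟨z, hz⟩ := exists_seq_eq_apply_sum_range fun k s => |c ((4 : ℝ) ^ k • s)|
  have hz0 (k : ℕ) : 0 ≤ z k := hz k ▸ abs_nonneg _
  let s (k : ℕ) : E := (4 : ℝ) ^ k • ∑ i ∈ Finset.range k, z i
  have hs (k : ℕ) : 0 ≤ s k := smul_nonneg (by positivity) (Finset.sum_nonneg fun i _ => hz0 i)
  have hbdd : Bornology.IsBounded (Set.range z) := by
    obtain ⟨C, hC⟩ := hA.exists_norm_le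
    refine isBounded_iff_forall_norm_le.2 ⟨C, Set.forall_mem_range.2 fun k => ?_⟩
    rw [hz k, norm_abs_eq_norm]
    exact hC _ (hcA _ (hs k))
  obtain ⟨Y, hzY⟩ := exists_forall_half_pow_smul_le hz0 hbdd
  have hY : 0 ≤ Y := (hz0 0).trans (by simpa using hzY 0)
  have hv := h (disjointification z Y) (fun k => posPart_nonneg _)
    (pairwise_disjointification_inf_eq_zero hz0 hzY)
    fun k => ⟨_, hcA _ (hs k), (disjointification_le hz0 hY k).trans_eq (hz k)⟩
  have hlim : Tendsto (fun k => f (disjointification z Y k) + (1 / 2) ^ k * f Y) atTop (𝓝 0) := by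
    simpa using hv.add ((tendsto_pow_atTop_nhds_zero_of_lt_one one_half_pos.le
      one_half_lt_one).mul_const (f Y))
  refine hε.not_ge (ge_of_tendsto' hlim fun k => ?_)
  calc ε ≤ f (z k - s k)⁺ := by rw [hz k]; exact (hc _ (hs k)).le
    _ ≤ f (disjointification z Y k + (1 / 2 : ℝ) ^ k • Y) :=
      hf (posPart_le_disjointification_add hY k)
    _ = _ := by rw [map_add, map_smul, smul_eq_mul]

theorem WeakTendsto.almostOrderBounded_range {y : ℕ → E} {b : E} (hy : WeakTendsto y atTop b)
    {f : StrongDual ℝ E} (hf : Monotone f) : AlmostOrderBounded f (Set.range y) := by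
  refine almostOrderBounded_of_disjoint hf hy.relativelyWeaklyCompact_range.isBounded
    fun v hv hdisj hvy => ?_
  choose m hm using fun k => Set.exists_range_iff.1 (hvy k)
  exact hy.tendsto_apply_of_disjoint hf hv hdisj hm

theorem UawTendsto.tendsto_apply_abs_sub {y : ℕ → E} {b : E} (hy : WeakTendsto y atTop b)
    (hxy : ∀ᶠ i in l, x i ∈ Set.range y) (hx : UawTendsto x l a) {f : StrongDual ℝ E}
    (hf : Monotone f) : Tendsto (fun i => f |x i - a|) l (𝓝 0) :=
  ((hy.sub_const a).almostOrderBounded_range hf).tendsto_apply_abs hf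
    (hxy.mono fun _ ⟨n, hn⟩ => ⟨n, congrArg (· - a) hn⟩)
    fun u hu => by simpa only [sub_zero] using hx u hu

theorem WeakTendsto.mapClusterPt_apply_abs {y : ℕ → E} (hy : WeakTendsto y atTop 0) {G : Filter E}
    [G.NeBot] (hG : G ≤ map y atTop) (ha : UawTendsto id G a) {f : StrongDual ℝ E}
    (hf : Monotone f) : MapClusterPt 0 atTop fun n => f |y n| := by
  have hrange : ∀ᶠ z in G, z ∈ Set.range y :=
    hG (mem_map.2 (Eventually.of_forall Set.mem_range_self))
  have hG0 : WeakTendsto id G 0 := (tendsto_map'_iff.2 hy).mono_left hG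
  have hGa : WeakTendsto id G a :=
    weakTendsto_of_tendsto_apply_abs fun _ hg => ha.tendsto_apply_abs_sub hy hrange hg
  obtain rfl := hGa.unique hG0
  have hlim : Tendsto (fun z => f |z|) G (𝓝 0) := by
    simpa using ha.tendsto_apply_abs_sub hy hrange hf
  exact hlim.mapClusterPt.mono hG

end AlmostOrderBounded

theorem exists_directed_tendsto {ι : Type u} (F : Filter ι) [F.NeBot] :
    ∃ (κ : Type u) (_ : Preorder κ) (_ : IsDirectedOrder κ) (_ : Nonempty κ) (φ : κ → ι),
      Tendsto φ atTop F := by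
  have hdir : IsDirectedOrder {s // s ∈ F}ᵒᵈ := ⟨fun s t =>
    ⟨⟨_, inter_mem s.2 t.2⟩, Set.inter_subset_left, Set.inter_subset_right⟩⟩
  refine ⟨{s // s ∈ F}ᵒᵈ, inferInstance, hdir, ⟨⟨_, univ_mem⟩⟩,
    fun s => (F.nonempty_of_mem s.2).some, fun s hs => ?_⟩
  refine mem_map.2 (mem_of_superset (Ici_mem_atTop (OrderDual.toDual ⟨s, hs⟩)) fun t ht => ?_)
  exact ht (F.nonempty_of_mem t.2).some_mem

theorem relativelyUawCompact_iff {E : Type u} [NormedAddCommGroup E] [NormedSpace ℝ E] [Lattice E]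
    {A : Set E} :
    RelativelyUawCompact A ↔ Bornology.IsBounded A ∧ ∀ F : Filter E, F.NeBot → F ≤ 𝓟 A →
      ∃ G ≤ F, G.NeBot ∧ ∃ a, UawTendsto id G a := by
  refine and_congr_right fun _ => ⟨fun h F _ hF => ?_, fun h ι _ _ _ x hx => ?_⟩
  · have : (comap ((↑) : A → E) F).NeBot := comap_coe_neBot_of_le_principal hF
    obtain ⟨ι, _, _, _, x, hx⟩ := exists_directed_tendsto (comap ((↑) : A → E) F)
    obtain ⟨κ, _, _, _, φ, hφ, a, ha⟩ := h ι (fun i => x i) fun i => (x i).2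
    exact ⟨map (fun k => x (φ k)) atTop, (tendsto_comap_iff.1 hx).comp hφ, inferInstance, a,
      fun u hu => tendsto_map'_iff.2 (ha u hu)⟩
  · obtain ⟨G, hG, _, a, ha⟩ := h (map x atTop) inferInstance
      (le_principal_iff.2 (mem_map.2 (Eventually.of_forall hx)))
    have : (atTop ⊓ comap x G).NeBot :=
      neBot_inf_comap_iff_map.2 (by rwa [inf_eq_right.2 hG])
    obtain ⟨κ, _, _, _, φ, hφ⟩ := exists_directed_tendsto (atTop ⊓ comap x G)
    exact ⟨κ, _, ‹_›, ‹_›, φ, hφ.mono_right inf_le_left, a, fun u hu =>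
      (ha u hu).comp (tendsto_comap_iff.1 (hφ.mono_right inf_le_right))⟩

theorem proposition3p20 {E : Type*} [NormedAddCommGroup E] [NormedSpace ℝ E] [CompleteSpace E]
    [Lattice E] [IsOrderedAddMonoid E] [IsOrderedModule ℝ E] [HasSolidNorm E] :
    WeaklySeqContinuousLatticeOps E ↔
      ∀ A : Set E, RelativelyWeaklyCompact A → RelativelyUawCompact A := by
  constructor
  · refine fun h A hA => relativelyUawCompact_iff.2 ⟨hA.isBounded, fun F _ hF => ?_⟩
    obtain ⟨G, hG, hne, a, ha⟩ := hA.exists_le_weakTendsto F hF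
    exact ⟨G, hG, hne, a, h.uawTendsto hA (le_principal_iff.1 (hG.trans hF)) ha⟩
  · refine fun h => weaklySeqContinuousLatticeOps_iff.2 fun x hx =>
      weakTendsto_of_tendsto_apply_abs fun f hf => tendsto_of_subseq_tendsto fun θ hθ => ?_
    have hxθ : WeakTendsto (x ∘ θ) atTop 0 := hx.comp hθ
    obtain ⟨-, hfilter⟩ := relativelyUawCompact_iff.1 (h _ hxθ.relativelyWeaklyCompact_range)
    obtain ⟨G, hG, _, a, ha⟩ := hfilter (map (x ∘ θ) atTop) inferInstance
      (le_principal_iff.2 (mem_map.2 (Eventually.of_forall Set.mem_range_self)))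
    obtain ⟨ψ, -, hψ⟩ := (hxθ.mapClusterPt_apply_abs hG ha hf).tendsto_subseq
    exact ⟨ψ, by simpa [Function.comp_def] using hψ⟩
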